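/- **Lemma (Tetrahedron Property).** Let $n\ge 2$. Let $\Delta$ be a locally finite building of type $\tilde A_{n-1}$, that is, a simplicial complex in which the link of every vertex is finite, with a system of subcomplexes (apartments), each isomorphic to the Coxeter complex of type $\tilde A_{n-1}$, such that any two simplices lie in a common apartment and any two apartments are isomorphic by an isomorphism fixing their intersection. Number the nodes of the Coxeter diagram cyclically by $1,\dots,n$ (for $n=2$ the Coxeter group is the infinite dihedral group), label the vertex $w\langle S\setminus\{s_i\}\rangle$ of the Coxeter complex by $i$, and let $\ell$ be a labeling of the vertices of $\Delta$ by $\{1,\dots,n\}$, regarded as residues modulo $n$, that restricts to this labeling on every apartment (under some identification of the apartment with the Coxeter complex). Let $\Gamma_\Delta$ be the directed graph whose vertices are the vertices of $\Delta$ and which has the two edges $x\to y$ and $y\to x$ for every $1$-simplex $\{x,y\}$ of $\Delta$; the edge $x\to y$ has as its label the representative of $\ell(x)-\ell(y)$ modulo $n$ in $\{0,\dots,n-1\}$. Let $a,b,c,d$ be vertices such that the cycles $a\to b\to c\to a$ and $a\to d\to b\to a$ exist in $\Gamma_\Delta$ and the sum of the labels of the edges $a\to d$, $d\to b$ and $b\to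 c$ is less than $n$. Then $c$ and $d$ are joined by an edge, and therefore the cycles $a\to c\to d\to a$ and $b\to d\to c\to b$ exist in $\Gamma_\Delta$. -/

import Mathlib

open scoped Pointwise

/-! ### Coxeter complexes -/

/-- The special subgroup `⟨J⟩` of the Coxeter group of `M` generated by a set `J` of simple
reflections. -/
def specialSubgroup {B : Type*} (M : CoxeterMatrix B) (J : Set B) : Subgroup M.Group :=
  Subgroup.closure (M.simple '' J)

/-- The special cosets `w⟨J⟩` other than the whole group, as subsets of the Coxeter group, ordered by
inclusion. (The whole group is the special coset that represents the empty simplex.) -/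
abbrev ProperSpecialCoset {B : Type*} (M : CoxeterMatrix B) : Type _ :=
  {C : Set M.Group // (∃ (w : M.Group) (J : Set B), C = w • (specialSubgroup M J : Set M.Group)) ∧
    C ≠ Set.univ}

/-- Isomorphisms of the simplicial complex `K`, given as its poset of (nonempty) simplices, with the
Coxeter complex of `M`: the poset of special cosets under reverse inclusion. -/
abbrev CoxeterComplexIso {B : Type*} (M : CoxeterMatrix B) {V : Type*}
    (K : PreAbstractSimplicialComplex V) : Type _ :=
  K ≃o (ProperSpecialCoset M)ᵒᵈ

/-- The Coxeter matrix of type `Ã_{n-1}`, with simple reflections indexed by `ZMod n`: the Coxeter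
diagram is the cycle through `1, 2, …, n = 0`; for `n = 2` the two reflections generate the infinite
dihedral group (the entry `0` stands for `∞`). Meaningful for `2 ≤ n`. -/
def affineAMatrix (n : ℕ) : CoxeterMatrix (ZMod n) where
  M := Matrix.of fun i j =>
    if i = j then 1 else if j = i + 1 ∨ i = j + 1 then (if n = 2 then 0 else 3) else 2
  isSymm := by
    ext i j
    simp only [Matrix.transpose_apply, Matrix.of_apply, eq_comm (a := j) (b := i),
      or_comm (a := i = j + 1)]
  diagonal := by simp
  off_diagonal := by
    intro i j h
    simp only [Matrix.of_apply, if_neg h]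
    split_ifs <;> norm_num

/-! ### Buildings -/

/-- `Δ` is a building and `𝒜` is a system of apartments for it. -/
structure IsBuilding {V : Type*} (Δ : AbstractSimplicialComplex V)
    (𝒜 : Set (PreAbstractSimplicialComplex V)) : Prop where
  /-- Apartments are subcomplexes. -/
  le : ∀ K ∈ 𝒜, K ≤ Δ.toPreAbstractSimplicialComplex
  /-- Each apartment is a Coxeter complex. -/
  coxeter : ∀ K ∈ 𝒜, ∃ (B : Type) (_ : Finite B) (M : CoxeterMatrix B),
    Nonempty (CoxeterComplexIso M K)
  /-- Some apartment contains the empty simplex. -/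
  nonempty : 𝒜.Nonempty
  /-- Any two simplices lie in a common apartment. -/
  common : ∀ s ∈ Δ, ∀ t ∈ Δ, ∃ K ∈ 𝒜, s ∈ K ∧ t ∈ K
  /-- Any two apartments are isomorphic by an isomorphism that fixes their intersection. -/
  iso : ∀ K ∈ 𝒜, ∀ L ∈ 𝒜, ∃ φ : K ≃o L, ∀ (s : Finset V) (hK : s ∈ K), s ∈ L →
    (φ ⟨s, hK⟩ : Finset V) = s

/-- The apartments in `𝒜` are Coxeter complexes of type `Ã_{n-1}`. -/
def IsTypeAffineA {V : Type*} (n : ℕ) (𝒜 : Set (PreAbstractSimplicialComplex V)) : Prop :=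
  ∀ K ∈ 𝒜, Nonempty (CoxeterComplexIso (affineAMatrix n) K)

/-- The link of a simplex `s`: the simplices that are disjoint from `s` and joinable to `s`. -/
def simplexLink {V : Type*} (Δ : AbstractSimplicialComplex V) (s : Finset V) : Set (Finset V) :=
  {t | t ∈ Δ ∧ Disjoint t s ∧ ∃ u ∈ Δ, t ⊆ u ∧ s ⊆ u}

/-- The link of every vertex is finite. -/
def IsLocallyFinite {V : Type*} (Δ : AbstractSimplicialComplex V) : Prop :=
  ∀ v : V, (simplexLink Δ {v}).Finite

/-- `ℓ` is a labeling of the vertices, by the elements of `{1, …, n}` read modulo `n`, that restricts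
on each apartment `K` to the canonical labeling of the Coxeter complex of type `Ã_{n-1}`: under some
identification of `K` with the Coxeter complex, every vertex `v` of `K` is a coset of the special
subgroup generated by all simple reflections except the one with index `ℓ v`. -/
def IsConsistentLabeling {V : Type*} (n : ℕ) (𝒜 : Set (PreAbstractSimplicialComplex V))
    (ℓ : V → ZMod n) : Prop :=
  ∀ K ∈ 𝒜, ∃ φ : CoxeterComplexIso (affineAMatrix n) K, ∀ (v : V) (hv : {v} ∈ K),
    ∃ w : (affineAMatrix n).Group,
      (OrderDual.ofDual (φ ⟨{v}, hv⟩)).1 =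
        w • (specialSubgroup (affineAMatrix n) {ℓ v}ᶜ : Set (affineAMatrix n).Group)

/-! ### The graph `Γ_Δ` -/

/-- The 1-skeleton of `Δ`: distinct vertices `x`, `y` are adjacent when `{x, y}` is a 1-simplex.
As a directed graph it has the edges `x → y` and `y → x` for each such pair. -/
def skeletonGraph {V : Type*} (Δ : AbstractSimplicialComplex V) : SimpleGraph V where
  Adj x y := x ≠ y ∧ ∃ e ∈ Δ, (e : Set V) = {x, y}
  symm := ⟨fun x y h => ⟨h.1.symm, by rw [Set.pair_comm]; exact h.2⟩⟩
  loopless := ⟨fun _ h => h.1 rfl⟩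

/-- The label of the edge `x → y`: the representative of `ℓ x - ℓ y mod n` in `{0, …, n - 1}`. -/
def edgeLabel {V : Type*} {n : ℕ} (ℓ : V → ZMod n) (x y : V) : ℕ :=
  (ℓ x - ℓ y).val

/-- The cycle `x → y → z → x` exists in the graph `Γ`. -/
def HasCycle {V : Type*} (Γ : SimpleGraph V) (x y z : V) : Prop :=
  Γ.Adj x y ∧ Γ.Adj y z ∧ Γ.Adj z x

/-! Adjacent vertices have distinct labels, so the three labels in the sum are positive, `n ≥ 3`,
and labels add along `a → d → b → c` without wrapping. Hence `ℓ d` and `ℓ c` lie on opposite arcs of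
the Coxeter diagram with the nodes `ℓ a`, `ℓ b` removed.

Triangles in the 1-skeleton are filled (`IsBuilding.triple_mem`), so `{a, b, c}` and `{a, b, d}` are
simplices, and one apartment contains both. There, choose `g` common to the cosets of `a, b, c` and
`h` common to those of `a, b, d`. Then `g⁻¹ * h` lies in the special subgroup omitting `ℓ a` and `ℓ
b`. No node of one arc is joined to a node of the other, so `g⁻¹ * h = u * v` with `u` and `v`
supported on the arcs of `ℓ d` and `ℓ c` respectively. The element `g * u = h * v⁻¹` lies in the
cosets of both `c` and `d`, which are therefore adjacent.

The group theory behind this, intersections of special subgroups and of their products, rests on the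
exchange condition. -/

/-! ### Exchange condition and special subgroups of Coxeter groups. -/

namespace CoxeterSystem

variable {B W : Type*} [Group W] {M : CoxeterMatrix B} (cs : CoxeterSystem M W)

theorem reverse_alternatingWord_two_mul (i j : B) (m : ℕ) :
    (alternatingWord i j (2 * m)).reverse = alternatingWord j i (2 * m) := by
  induction m with
  | zero => simp [alternatingWord]
  | succ m ih =>
    have h : 2 * (m + 1) = 2 * m + 1 + 1 := by ring
    rw [h, alternatingWord_succ', alternatingWord_succ', alternatingWord_succ,
      alternatingWord_succ]
    simp [ih, List.concat_eq_append]

/-- Entries `k` and `M i j + k` agree because `(s_i s_j) ^ M i j = 1`; so every reflection occurs an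
even number of times, as the braid relations for `signedConj` require. -/
theorem leftInvSeq_alternatingWord_two_mul (i j : B) :
    ∃ l : List W, cs.leftInvSeq (alternatingWord i j (2 * M i j)) = l ++ l := by
  refine ⟨List.ofFn fun k : Fin (M i j) => cs.wordProd (alternatingWord j i (2 * k + 1)), ?_⟩
  apply List.ext_getElem
  · simp; ring
  · intro k h₁ h₂
    rw [cs.getElem_leftInvSeq_alternatingWord i j (M i j) k (by simpa using h₁), List.getElem_append]
    split_ifs with hk
    · simp
    · have hk' : M i j ≤ k := by simpa using hk
      obtain ⟨r, rfl⟩ := Nat.exists_eq_add_of_le hk'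
      have e₁ : (2 * (M i j + r) + 1) / 2 = M i j + r := by omega
      have e₂ : (2 * r + 1) / 2 = r := by omega
      simp [prod_alternatingWord_eq_mul_pow, e₁, e₂, pow_add]

open Classical in
/-- The action of a simple reflection on pairs of a group element and a sign. -/
noncomputable def signedConj (i : B) : Function.End (W × ZMod 2) := fun p =>
  (cs.simple i * p.1 * cs.simple i, p.2 + if p.1 = cs.simple i then 1 else 0)

open Classical in
theorem prod_map_signedConj (ω : List B) (p : W × ZMod 2) :
    (ω.map cs.signedConj).prod p =
      (cs.wordProd ω * p.1 * (cs.wordProd ω)⁻¹, p.2 + ((cs.rightInvSeq ω).count p.1 : ℕ)) := by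
  induction ω with
  | nil => simp; rfl
  | cons i ω ih =>
    rw [List.map_cons, List.prod_cons]
    change cs.signedConj i ((ω.map cs.signedConj).prod p) = _
    rw [ih]
    have h : cs.wordProd ω * p.1 * (cs.wordProd ω)⁻¹ = cs.simple i ↔
        (cs.wordProd ω)⁻¹ * cs.simple i * cs.wordProd ω = p.1 := by
      constructor <;> intro h
      · rw [← h]; group
      · rw [← h]; group
    simp only [mul_assoc] at h
    simp only [signedConj, rightInvSeq, wordProd_cons, mul_inv_rev, inv_simple, List.count_cons,
      beq_iff_eq, h, Nat.cast_add, Nat.cast_ite, Nat.cast_one, Nat.cast_zero, mul_assoc, add_assoc]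

theorem prod_map_alternatingWord_two_mul {G : Type*} [Monoid G] (f : B → G) (i j : B) (m : ℕ) :
    ((alternatingWord i j (2 * m)).map f).prod = (f i * f j) ^ m := by
  induction m with
  | zero => simp [alternatingWord]
  | succ m ih =>
    have h : 2 * (m + 1) = 2 * m + 1 + 1 := by ring
    rw [h, alternatingWord_succ', alternatingWord_succ']
    simp [ih, pow_succ', mul_assoc]

theorem isLiftable_signedConj : M.IsLiftable cs.signedConj := by
  classical
  intro i j
  rw [← prod_map_alternatingWord_two_mul]
  funext p
  rw [prod_map_signedConj]
  have hw : cs.wordProd (alternatingWord i j (2 * M i j)) = 1 := by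
    simp [prod_alternatingWord_eq_mul_pow]
  obtain ⟨l, hl⟩ := cs.leftInvSeq_alternatingWord_two_mul j i
  have hr : cs.rightInvSeq (alternatingWord i j (2 * M i j)) = (l ++ l).reverse := by
    rw [← hl, ← rightInvSeq_reverse, M.symmetric j i, reverse_alternatingWord_two_mul]
  rw [hw, hr, List.count_reverse, List.count_append, ← two_mul]
  have h2 : (2 : ZMod 2) = 0 := rfl
  simp [h2]
  rfl

-- The sign change under the action of a word is this parity, and the action factors through the
-- group.
open Classical in
theorem count_rightInvSeq_eq {ω ω' : List B} (h : cs.wordProd ω = cs.wordProd ω') (t : W) :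
    ((cs.rightInvSeq ω).count t : ZMod 2) = (cs.rightInvSeq ω').count t := by
  have key : ∀ ω : List B, (ω.map cs.signedConj).prod =
      cs.lift ⟨_, cs.isLiftable_signedConj⟩ (cs.wordProd ω) := by
    intro ω
    rw [wordProd, map_list_prod, List.map_map]
    congr 1
    apply List.map_congr_left
    intro i _
    simp
  have := congrArg (fun g : Function.End (W × ZMod 2) => g (t, 0))
    ((key ω).trans ((congrArg _ h).trans (key ω').symm))
  simp only [prod_map_signedConj] at this
  simpa using congrArg Prod.snd this

/-- The exchange condition. -/
theorem exists_eraseIdx_of_isRightDescent {ω : List B} {i : B}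
    (h : cs.IsRightDescent (cs.wordProd ω) i) :
    ∃ j < ω.length, cs.wordProd ω * cs.simple i = cs.wordProd (ω.eraseIdx j) := by
  classical
  obtain ⟨ρ, hρ, hw⟩ := cs.exists_isReduced (cs.wordProd ω * cs.simple i)
  have hprod : cs.wordProd ω = cs.wordProd (ρ.concat i) := by
    rw [wordProd_concat, ← hw]; simp
  have hred : cs.IsReduced (ρ.concat i) := by
    rw [IsReduced, ← hprod]
    have h₁ := (cs.isRightDescent_iff).1 h
    rw [hw, hρ.eq] at h₁
    simp [h₁]
  -- In the reduced word `ρ.concat i` the reflection `s_i` occurs exactly once, an odd number, so it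
  -- also occurs for `ω`; its position is the letter to delete.
  have hc := cs.count_rightInvSeq_eq hprod (cs.simple i)
  have hmem : cs.simple i ∈ cs.rightInvSeq (ρ.concat i) := by
    rw [rightInvSeq_concat]; simp
  rw [List.count_eq_one_of_mem hred.nodup_rightInvSeq hmem] at hc
  have hmem' : cs.simple i ∈ cs.rightInvSeq ω := by
    by_contra hn
    rw [List.count_eq_zero_of_not_mem hn] at hc
    simp at hc
  obtain ⟨j, hj, hji⟩ := List.getElem_of_mem hmem'
  refine ⟨j, by simpa using hj, ?_⟩
  rw [← wordProd_mul_getD_rightInvSeq, List.getD_eq_getElem _ _ hj, hji]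

/-- Read the word letter by letter: a letter that lowers the length cancels an earlier one, by
exchange. -/
theorem exists_reduced_sublist (ω : List B) :
    ∃ ρ : List B, ρ.Sublist ω ∧ cs.IsReduced ρ ∧ cs.wordProd ρ = cs.wordProd ω := by
  induction ω using List.reverseRecOn with
  | nil => exact ⟨[], List.Sublist.refl _, by simp [IsReduced], rfl⟩
  | append_singleton ω i ih =>
    obtain ⟨ρ, hs, hr, hp⟩ := ih
    by_cases h : cs.IsRightDescent (cs.wordProd ρ) i
    · obtain ⟨j, hj, he⟩ := cs.exists_eraseIdx_of_isRightDescent h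
      refine ⟨ρ.eraseIdx j, ((List.eraseIdx_sublist _ _).trans hs).trans
        (List.sublist_append_left _ _), ?_, ?_⟩
      · have := (cs.isRightDescent_iff).1 h
        rw [he, hr.eq] at this
        rw [IsReduced, List.length_eraseIdx_of_lt hj]
        omega
      · rw [← he, wordProd_append, hp]; simp
    · refine ⟨ρ ++ [i], hs.append (List.Sublist.refl _), ?_, by simp [wordProd_append, hp]⟩
      have := (cs.not_isRightDescent_iff).1 h
      rw [IsReduced, wordProd_append, wordProd_singleton, this, hr.eq]
      simp

theorem mem_closure_simple_iff (J : Set B) (w : W) :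
    w ∈ Subgroup.closure (cs.simple '' J) ↔
      ∃ ω : List B, (∀ i ∈ ω, i ∈ J) ∧ cs.wordProd ω = w := by
  constructor
  · intro hw
    induction hw using Subgroup.closure_induction with
    | mem x hx =>
      obtain ⟨i, hi, rfl⟩ := hx
      exact ⟨[i], by simpa using hi, by simp⟩
    | one => exact ⟨[], by simp, by simp⟩
    | mul x y _ _ hx hy =>
      obtain ⟨ω, h, rfl⟩ := hx
      obtain ⟨ρ, h', rfl⟩ := hy
      refine ⟨ω ++ ρ, ?_, by simp [wordProd_append]⟩
      intro i hi
      rcases List.mem_append.1 hi with hi | hi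
      exacts [h i hi, h' i hi]
    | inv x _ hx =>
      obtain ⟨ω, h, rfl⟩ := hx
      exact ⟨ω.reverse, by simpa using h, by simp⟩
  · rintro ⟨ω, h, rfl⟩
    refine Subgroup.list_prod_mem _ ?_
    intro x hx
    obtain ⟨i, hi, rfl⟩ := List.mem_map.1 hx
    exact Subgroup.subset_closure ⟨i, h i hi, rfl⟩

theorem exists_reduced_of_mem_closure {J : Set B} {w : W}
    (hw : w ∈ Subgroup.closure (cs.simple '' J)) :
    ∃ ω : List B, (∀ i ∈ ω, i ∈ J) ∧ cs.IsReduced ω ∧ cs.wordProd ω = w := by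
  obtain ⟨ω, h, rfl⟩ := (cs.mem_closure_simple_iff J w).1 hw
  obtain ⟨ρ, hs, hr, hp⟩ := cs.exists_reduced_sublist ω
  exact ⟨ρ, fun i hi => h i (hs.subset hi), hr, hp⟩

theorem mem_of_simple_mem_closure (hinj : Function.Injective cs.simple) {J : Set B} {i : B}
    (h : cs.simple i ∈ Subgroup.closure (cs.simple '' J)) : i ∈ J := by
  obtain ⟨ω, hJ, hr, hp⟩ := cs.exists_reduced_of_mem_closure h
  have hl := hr.eq
  rw [hp, length_simple] at hl
  obtain ⟨k, rfl⟩ := List.length_eq_one_iff.1 hl.symm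
  rw [wordProd_singleton] at hp
  exact hinj hp ▸ hJ k (by simp)

/-- The last letter is a right descent; exchange in a `J`-word for the same element puts this
reflection in `⟨J⟩`, hence the letter in `J`. Strip it and induct. -/
theorem IsReduced.forall_mem_of_mem_closure (hinj : Function.Injective cs.simple) {J : Set B}
    {ω : List B} (hr : cs.IsReduced ω) (h : cs.wordProd ω ∈ Subgroup.closure (cs.simple '' J)) :
    ∀ i ∈ ω, i ∈ J := by
  induction ω using List.reverseRecOn with
  | nil => simp
  | append_singleton ω i ih =>
    have hω : cs.IsReduced ω := by simpa using hr.take ω.length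
    have hd : cs.IsRightDescent (cs.wordProd (ω ++ [i])) i := by
      rw [IsRightDescent, hr.eq]
      simp [wordProd_append, hω.eq]
    have hi : i ∈ J := by
      obtain ⟨ρ, hρ, he⟩ := (cs.mem_closure_simple_iff J _).1 h
      rw [← he] at hd
      obtain ⟨j, -, hj⟩ := cs.exists_eraseIdx_of_isRightDescent hd
      apply cs.mem_of_simple_mem_closure hinj
      have h₁ : cs.wordProd ρ * cs.simple i ∈ Subgroup.closure (cs.simple '' J) :=
        hj ▸ (cs.mem_closure_simple_iff J _).2
          ⟨_, fun k hk => hρ k ((List.eraseIdx_sublist _ _).subset hk), rfl⟩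
      exact (Subgroup.mul_mem_cancel_left _ (he ▸ h)).1 h₁
    have hs : cs.simple i ∈ Subgroup.closure (cs.simple '' J) :=
      Subgroup.subset_closure ⟨i, hi, rfl⟩
    rw [wordProd_append, wordProd_singleton, Subgroup.mul_mem_cancel_right _ hs] at h
    intro k hk
    rcases List.mem_append.1 hk with hk | hk
    · exact ih hω h k hk
    · rw [List.mem_singleton.1 hk]; exact hi

theorem mem_closure_inter (hinj : Function.Injective cs.simple) {I J : Set B} {w : W}
    (hI : w ∈ Subgroup.closure (cs.simple '' I)) (hJ : w ∈ Subgroup.closure (cs.simple '' J)) :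
    w ∈ Subgroup.closure (cs.simple '' (I ∩ J)) := by
  obtain ⟨ω, h, hr, rfl⟩ := cs.exists_reduced_of_mem_closure hI
  exact (cs.mem_closure_simple_iff _ _).2
    ⟨ω, fun i hi => ⟨h i hi, hr.forall_mem_of_mem_closure cs hinj hJ i hi⟩, rfl⟩

/-- A reduced subword of a `J`-word followed by a `K`-word splits in the same way, and all its
letters lie in `I`. -/
theorem exists_mul_of_mem_closure (hinj : Function.Injective cs.simple) {I J K : Set B}
    {q r : W} (hq : q ∈ Subgroup.closure (cs.simple '' J))
    (hr : r ∈ Subgroup.closure (cs.simple '' K))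
    (h : q * r ∈ Subgroup.closure (cs.simple '' I)) :
    ∃ x ∈ Subgroup.closure (cs.simple '' (I ∩ J)),
      ∃ y ∈ Subgroup.closure (cs.simple '' (I ∩ K)), x * y = q * r := by
  obtain ⟨ω, hω, rfl⟩ := (cs.mem_closure_simple_iff _ _).1 hq
  obtain ⟨ρ, hρ, rfl⟩ := (cs.mem_closure_simple_iff _ _).1 hr
  obtain ⟨σ, hs, hσ, hp⟩ := cs.exists_reduced_sublist (ω ++ ρ)
  obtain ⟨ω', ρ', rfl, hω', hρ'⟩ := List.sublist_append_iff.1 hs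
  rw [wordProd_append (ω := ω)] at hp
  rw [← hp] at h
  have hI := hσ.forall_mem_of_mem_closure cs hinj h
  refine ⟨cs.wordProd ω', (cs.mem_closure_simple_iff _ _).2 ⟨ω', fun i hi =>
    ⟨hI i (by simp [hi]), hω i (hω'.subset hi)⟩, rfl⟩, cs.wordProd ρ',
    (cs.mem_closure_simple_iff _ _).2 ⟨ρ', fun i hi =>
    ⟨hI i (by simp [hi]), hρ i (hρ'.subset hi)⟩, rfl⟩, ?_⟩
  rw [← hp, wordProd_append]

end CoxeterSystem

/-! ### The Coxeter group of type `Ã_{n-1}`. -/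

theorem ZMod.one_ne_zero_of_three_le {n : ℕ} (hn : 3 ≤ n) : (1 : ZMod n) ≠ 0 := by
  have : Fact (1 < n) := ⟨by omega⟩
  exact one_ne_zero

theorem ZMod.two_ne_zero_of_three_le {n : ℕ} (hn : 3 ≤ n) : (1 + 1 : ZMod n) ≠ 0 := by
  intro h
  have h2 : ((2 : ℕ) : ZMod n) = 0 := by
    rw [← h]; norm_num
  have := Nat.le_of_dvd (by norm_num) ((ZMod.natCast_eq_zero_iff 2 n).1 h2)
  omega

theorem swap_mul_swap_pow_three {α : Type*} [Finite α] [DecidableEq α] {a b c : α} (hab : a ≠ b)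
    (hac : a ≠ c) (hbc : b ≠ c) : (Equiv.swap a b * Equiv.swap b c) ^ 3 = 1 := by
  have := Fintype.ofFinite α
  rw [Equiv.swap_comm a b,
    ← (Equiv.Perm.isThreeCycle_swap_mul_swap_same hab.symm hbc hac).orderOf, pow_orderOf_eq_one]

theorem affineAMatrix_apply {n : ℕ} (i j : ZMod n) : affineAMatrix n i j =
    if i = j then 1 else if j = i + 1 ∨ i = j + 1 then (if n = 2 then 0 else 3) else 2 := rfl

theorem affineAMatrix_isLiftable_swap {n : ℕ} (hn : 3 ≤ n) :
    (affineAMatrix n).IsLiftable fun i : ZMod n => Equiv.swap i (i + 1) := by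
  have : NeZero n := ⟨by omega⟩
  have h1 := ZMod.one_ne_zero_of_three_le hn
  have h2 := ZMod.two_ne_zero_of_three_le hn
  have braid : ∀ i : ZMod n, (Equiv.swap i (i + 1) * Equiv.swap (i + 1) (i + 1 + 1)) ^ 3 = 1 :=
    fun i => swap_mul_swap_pow_three (by simpa using h1) (by simpa [add_assoc] using h2)
      (by simpa using h1)
  intro i j
  rw [affineAMatrix_apply]
  split_ifs with hij hadj hn2
  · simp [hij]
  · omega
  · rcases hadj with rfl | rfl
    · exact braid i
    · have := congrArg (·⁻¹) (braid j)
      simpa only [← inv_pow, mul_inv_rev, Equiv.swap_inv, inv_one] using this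
  · push Not at hadj
    have hc : Commute (Equiv.swap i (i + 1)) (Equiv.swap j (j + 1)) := by
      apply Equiv.Perm.Disjoint.commute
      intro x
      by_cases hx : x = i ∨ x = i + 1
      · right
        apply Equiv.swap_apply_of_ne_of_ne
        · rcases hx with rfl | rfl
          exacts [hij, hadj.1.symm]
        · rcases hx with rfl | rfl
          exacts [hadj.2, by simpa using hij]
      · push Not at hx
        exact Or.inl (Equiv.swap_apply_of_ne_of_ne hx.1 hx.2)
    rw [hc.mul_pow, pow_two, pow_two, Equiv.swap_mul_self, Equiv.swap_mul_self, one_mul]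

/-- The homomorphism `s_i ↦ (i, i+1)` to the permutations of `ZMod n` separates them: only `s_i`
sends `i` to `i + 1`, since `i - 1 ≠ i + 1` for `n ≥ 3`. -/
theorem affineAMatrix_simple_injective {n : ℕ} (hn : 3 ≤ n) :
    Function.Injective (affineAMatrix n).toCoxeterSystem.simple := by
  intro i k h
  have h1 := ZMod.one_ne_zero_of_three_le hn
  have h2 := ZMod.two_ne_zero_of_three_le hn
  have hs := congrArg
    ((affineAMatrix n).toCoxeterSystem.lift ⟨_, affineAMatrix_isLiftable_swap hn⟩) h
  rw [CoxeterSystem.lift_apply_simple, CoxeterSystem.lift_apply_simple] at hs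
  have hi := congrArg (fun g : Equiv.Perm (ZMod n) => g i) hs
  simp only [Equiv.swap_apply_left] at hi
  by_contra hik
  by_cases hk : i = k + 1
  · rw [hk, Equiv.swap_apply_right] at hi
    exact h2 (by simpa [add_assoc] using hi)
  · rw [Equiv.swap_apply_of_ne_of_ne hik hk] at hi
    exact h1 (by simpa using hi)

theorem affineAMatrix_simple_commute {n : ℕ} {i j : ZMod n} (h : i ≠ j + 1) (h' : j ≠ i + 1) :
    Commute ((affineAMatrix n).simple i) ((affineAMatrix n).simple j) := by
  have h := (affineAMatrix n).toCoxeterSystem.simple_mul_simple_pow i j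
  rw [affineAMatrix_apply] at h
  simp only [CoxeterMatrix.toCoxeterSystem_simple] at h
  by_cases hij : i = j
  · rw [hij]
  · rw [if_neg hij, if_neg (by tauto), pow_two] at h
    have hi := (affineAMatrix n).toCoxeterSystem.inv_simple i
    have hj := (affineAMatrix n).toCoxeterSystem.inv_simple j
    simp only [CoxeterMatrix.toCoxeterSystem_simple] at hi hj
    have := eq_inv_of_mul_eq_one_left h
    rwa [mul_inv_rev, hi, hj] at this

/-! ### Intersections of special cosets. -/

theorem mem_specialSubgroup_inter {n : ℕ} (hn : 3 ≤ n) {I J : Set (ZMod n)}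
    {w : (affineAMatrix n).Group} (hI : w ∈ specialSubgroup _ I) (hJ : w ∈ specialSubgroup _ J) :
    w ∈ specialSubgroup _ (I ∩ J) :=
  (affineAMatrix n).toCoxeterSystem.mem_closure_inter (affineAMatrix_simple_injective hn) hI hJ

theorem exists_mul_of_mem_specialSubgroup {n : ℕ} (hn : 3 ≤ n) {I J K : Set (ZMod n)}
    {q r : (affineAMatrix n).Group} (hq : q ∈ specialSubgroup _ J) (hr : r ∈ specialSubgroup (affineAMatrix n) K)
    (h : q * r ∈ specialSubgroup _ I) :
    ∃ x ∈ specialSubgroup _ (I ∩ J), ∃ y ∈ specialSubgroup _ (I ∩ K), x * y = q * r :=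
  (affineAMatrix n).toCoxeterSystem.exists_mul_of_mem_closure (affineAMatrix_simple_injective hn)
    hq hr h

theorem specialSubgroup_mono {B : Type*} (M : CoxeterMatrix B) {I J : Set B} (h : I ⊆ J) :
    specialSubgroup M I ≤ specialSubgroup M J :=
  Subgroup.closure_mono (Set.image_mono h)

/-- Pairwise intersecting cosets of special subgroups have a common element. -/
theorem exists_mem_three_cosets {n : ℕ} (hn : 3 ≤ n) {I J K : Set (ZMod n)}
    {x y z p q r : (affineAMatrix n).Group}
    (hpx : p ∈ x • (specialSubgroup (affineAMatrix n) I : Set (affineAMatrix n).Group))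
    (hpy : p ∈ y • (specialSubgroup (affineAMatrix n) J : Set (affineAMatrix n).Group))
    (hqy : q ∈ y • (specialSubgroup (affineAMatrix n) J : Set (affineAMatrix n).Group))
    (hqz : q ∈ z • (specialSubgroup (affineAMatrix n) K : Set (affineAMatrix n).Group))
    (hrz : r ∈ z • (specialSubgroup (affineAMatrix n) K : Set (affineAMatrix n).Group))
    (hrx : r ∈ x • (specialSubgroup (affineAMatrix n) I : Set (affineAMatrix n).Group)) :
    ∃ g, g ∈ x • (specialSubgroup (affineAMatrix n) I : Set (affineAMatrix n).Group) ∧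
      g ∈ y • (specialSubgroup (affineAMatrix n) J : Set (affineAMatrix n).Group) ∧
      g ∈ z • (specialSubgroup (affineAMatrix n) K : Set (affineAMatrix n).Group) := by
  simp only [mem_leftCoset_iff, SetLike.mem_coe] at *
  have h₁ : p⁻¹ * q ∈ specialSubgroup _ J := by
    simpa [mul_assoc] using mul_mem (inv_mem hpy) hqy
  have h₂ : q⁻¹ * r ∈ specialSubgroup _ K := by
    simpa [mul_assoc] using mul_mem (inv_mem hqz) hrz
  have h₃ : p⁻¹ * q * (q⁻¹ * r) ∈ specialSubgroup _ I := by
    simpa [mul_assoc] using mul_mem (inv_mem hpx) hrx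
  obtain ⟨u, hu, v, hv, huv⟩ := exists_mul_of_mem_specialSubgroup hn h₁ h₂ h₃
  -- As `u * v = p⁻¹ * r`, this element is also `r * v⁻¹`, which gives the third coset.
  refine ⟨p * u, ?_, ?_, ?_⟩
  · simpa [mul_assoc] using mul_mem hpx (specialSubgroup_mono _ Set.inter_subset_left hu)
  · simpa [mul_assoc] using mul_mem hpy (specialSubgroup_mono _ Set.inter_subset_right hu)
  · have e : p * u = r * v⁻¹ := by
      rw [eq_mul_inv_iff_mul_eq, mul_assoc, huv]; group
    rw [e, ← mul_assoc]
    exact mul_mem hrz (inv_mem (specialSubgroup_mono _ Set.inter_subset_right hv))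

/-- An element of the group generated by two commuting sets of simple reflections factors
accordingly. -/
theorem exists_mul_of_commute {B : Type*} {M : CoxeterMatrix B} {I J : Set B}
    (hc : ∀ i ∈ I, ∀ j ∈ J, Commute (M.simple i) (M.simple j)) {w : M.Group}
    (hw : w ∈ specialSubgroup M (I ∪ J)) :
    ∃ u ∈ specialSubgroup M I, ∃ v ∈ specialSubgroup M J, u * v = w := by
  have hle : specialSubgroup M J ≤ Subgroup.centralizer (specialSubgroup M I) := by
    rw [specialSubgroup, specialSubgroup, Subgroup.centralizer_closure, Subgroup.closure_le]
    rintro _ ⟨j, hj, rfl⟩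
    rw [SetLike.mem_coe, Subgroup.mem_centralizer_iff]
    rintro _ ⟨i, hi, rfl⟩
    exact hc i hi j hj
  have hle' : specialSubgroup M J ≤ Subgroup.normalizer (specialSubgroup M I : Set M.Group) :=
    hle.trans (Subgroup.centralizer_le_normalizer _)
  rw [specialSubgroup, Set.image_union, Subgroup.closure_union, ← specialSubgroup,
    ← specialSubgroup, ← SetLike.mem_coe,
    Subgroup.coe_mul_of_right_le_normalizer_left _ _ hle'] at hw
  exact Set.mem_mul.1 hw

/-- If two residues occur strictly on opposite sides of the pair `A, B` in the cyclic order, then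
cosets with these labels that are both adjacent to an `A, B`-edge intersect. -/
theorem exists_mem_cosets_of_opposite {n : ℕ} (hn : 3 ≤ n) {A B C D : ZMod n}
    (hD : (A - D).val < (A - B).val) (hC : (A - B).val < (A - C).val)
    {x y z t g h : (affineAMatrix n).Group}
    (hgx : g ∈ x • (specialSubgroup (affineAMatrix n) {A}ᶜ : Set (affineAMatrix n).Group))
    (hgy : g ∈ y • (specialSubgroup (affineAMatrix n) {B}ᶜ : Set (affineAMatrix n).Group))
    (hgz : g ∈ z • (specialSubgroup (affineAMatrix n) {C}ᶜ : Set (affineAMatrix n).Group))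
    (hhx : h ∈ x • (specialSubgroup (affineAMatrix n) {A}ᶜ : Set (affineAMatrix n).Group))
    (hhy : h ∈ y • (specialSubgroup (affineAMatrix n) {B}ᶜ : Set (affineAMatrix n).Group))
    (hht : h ∈ t • (specialSubgroup (affineAMatrix n) {D}ᶜ : Set (affineAMatrix n).Group)) :
    ∃ k, k ∈ z • (specialSubgroup (affineAMatrix n) {C}ᶜ : Set (affineAMatrix n).Group) ∧
      k ∈ t • (specialSubgroup (affineAMatrix n) {D}ᶜ : Set (affineAMatrix n).Group) := by
  have : NeZero n := ⟨by omega⟩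
  have : Fact (1 < n) := ⟨by omega⟩
  simp only [mem_leftCoset_iff, SetLike.mem_coe] at *
  have hA : g⁻¹ * h ∈ specialSubgroup (affineAMatrix n) {A}ᶜ := by
    simpa [mul_assoc] using mul_mem (inv_mem hgx) hhx
  have hB : g⁻¹ * h ∈ specialSubgroup (affineAMatrix n) {B}ᶜ := by
    simpa [mul_assoc] using mul_mem (inv_mem hgy) hhy
  -- The two arcs left by removing `A` and `B` from the cycle, parametrized by `(A - i).val`.
  have hsub : ({A}ᶜ ∩ {B}ᶜ : Set (ZMod n)) ⊆
      {i | 0 < (A - i).val ∧ (A - i).val < (A - B).val} ∪ {i | (A - B).val < (A - i).val} := by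
    rintro i ⟨hiA, hiB⟩
    have h₁ : (A - i).val ≠ 0 := by
      rw [Ne, ZMod.val_eq_zero, sub_eq_zero]
      exact fun e => hiA e.symm
    have h₂ : (A - i).val ≠ (A - B).val := by
      intro e
      exact hiB (sub_right_injective (ZMod.val_injective n e))
    simp only [Set.mem_union, Set.mem_ofPred_eq]
    omega
  -- Neighbouring nodes have consecutive values except at the wrap `i = A`. The value of `B`
  -- separates the arcs and `A` is in neither, so no node of one is adjacent to a node of the other.
  have hsucc : ∀ i j : ZMod n, j = i + 1 →
      (A - i).val = (A - j).val + 1 ∨ (A - i).val = 0 := by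
    rintro i _ rfl
    have e : A - i = (A - (i + 1)) + 1 := by ring
    rcases (Nat.succ_le_of_lt (ZMod.val_lt (A - (i + 1)))).lt_or_eq with hlt | heq
    · left
      rw [e, ZMod.val_add_of_lt (by rw [ZMod.val_one]; exact hlt), ZMod.val_one]
    · right
      rw [e, ZMod.val_add, ZMod.val_one, ← Nat.succ_eq_add_one, heq, Nat.mod_self]
  obtain ⟨u, hu, v, hv, huv⟩ := exists_mul_of_commute (fun i hi j hj => by
    simp only [Set.mem_ofPred_eq] at hi hj
    apply affineAMatrix_simple_commute
    · intro e
      have := hsucc j i e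
      omega
    · intro e
      have := hsucc i j e
      omega) (specialSubgroup_mono _ hsub (mem_specialSubgroup_inter hn hA hB))
  -- The arc of `u` omits `C` and that of `v` omits `D`, while `g * u = h * v⁻¹`.
  refine ⟨g * u, ?_, ?_⟩
  · rw [← mul_assoc]
    refine mul_mem hgz (specialSubgroup_mono _ ?_ hu)
    rintro i hi rfl
    exact absurd hi.2 (by omega)
  · have e : g * u = h * v⁻¹ := by
      rw [eq_mul_inv_iff_mul_eq, mul_assoc, huv]; group
    rw [e, ← mul_assoc]
    refine mul_mem hht (inv_mem (specialSubgroup_mono _ ?_ hv))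
    rintro i hi rfl
    exact absurd hi.out (by omega)

/-! ### Simplices of an apartment as intersections of vertex cosets. -/

/-- The special coset that an identification with the Coxeter complex assigns to the vertex `v`
(empty if `v` is not a vertex of `K`). -/
def vertexCoset {B V : Type*} {M : CoxeterMatrix B} {K : PreAbstractSimplicialComplex V}
    (φ : CoxeterComplexIso M K) (v : V) : Set M.Group :=
  {g | ∃ hv : {v} ∈ K, g ∈ (OrderDual.ofDual (φ ⟨{v}, hv⟩)).1}

theorem PreAbstractSimplicialComplex.mem_of_subset {V : Type*} (K : PreAbstractSimplicialComplex V)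
    {s t : Finset V} (ht : t ∈ K) (hst : s ⊆ t) (hs : s.Nonempty) : s ∈ K :=
  (K.isRelLowerSet_faces ht).2 hst hs

/-- The coset of a simplex is contained in those of its vertices. Conversely, a common element `g`
gives the chamber `{g} = g⟨∅⟩`, which has all these vertices. -/
theorem mem_iff_exists_mem_vertexCoset {B V : Type*} {M : CoxeterMatrix B}
    {K : PreAbstractSimplicialComplex V} (φ : CoxeterComplexIso M K) {s : Finset V}
    (hs : s.Nonempty) : s ∈ K ↔ ∃ g, ∀ v ∈ s, g ∈ vertexCoset φ v := by
  constructor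
  · intro h
    obtain ⟨w, J, hC⟩ := (OrderDual.ofDual (φ ⟨s, h⟩)).2.1
    refine ⟨w, fun v hv => ?_⟩
    have hvs : {v} ⊆ s := Finset.singleton_subset_iff.2 hv
    have hvK : {v} ∈ K := K.mem_of_subset h hvs (Finset.singleton_nonempty v)
    have hle : (⟨{v}, hvK⟩ : K) ≤ ⟨s, h⟩ := hvs
    have hle' : (OrderDual.ofDual (φ ⟨s, h⟩)).1 ⊆ (OrderDual.ofDual (φ ⟨{v}, hvK⟩)).1 :=
      φ.monotone hle
    refine ⟨hvK, hle' ?_⟩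
    rw [hC]
    exact ⟨1, one_mem _, by simp⟩
  · rintro ⟨g, hg⟩
    obtain ⟨v₀, hv₀⟩ := hs
    have hsingle : ∀ S : Set M.Group, g ∈ S → ({g} : Set M.Group) ⊆ S :=
      fun S h => Set.singleton_subset_iff.2 h
    -- Were `{g}` the whole group, so would be the coset of `v₀`, which is proper.
    let C : ProperSpecialCoset M := ⟨{g}, ⟨g, ∅, by simp [specialSubgroup]⟩, by
      obtain ⟨hv, hgv⟩ := hg v₀ hv₀
      intro h
      apply (OrderDual.ofDual (φ ⟨{v₀}, hv⟩)).2.2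
      exact Set.eq_univ_of_univ_subset (h.symm.subset.trans (hsingle _ hgv))⟩
    refine K.mem_of_subset (φ.symm (OrderDual.toDual C)).2 ?_ ⟨v₀, hv₀⟩
    intro v hvs
    obtain ⟨hv, hgv⟩ := hg v hvs
    have hle : φ ⟨{v}, hv⟩ ≤ OrderDual.toDual C := hsingle _ hgv
    have hle' : (⟨{v}, hv⟩ : K) ≤ φ.symm (OrderDual.toDual C) := φ.le_symm_apply.2 hle
    have hle'' : ({v} : Finset V) ⊆ (φ.symm (OrderDual.toDual C) : Finset V) := hle'
    exact Finset.singleton_subset_iff.1 hle''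

theorem vertexCoset_injOn {B V : Type*} {M : CoxeterMatrix B} {K : PreAbstractSimplicialComplex V}
    (φ : CoxeterComplexIso M K) {v w : V} (hv : {v} ∈ K) (hw : {w} ∈ K)
    (h : vertexCoset φ v = vertexCoset φ w) : v = w := by
  have e : φ ⟨{v}, hv⟩ = φ ⟨{w}, hw⟩ := by
    apply OrderDual.ofDual.injective
    apply Subtype.ext
    simpa [vertexCoset, hv, hw] using h
  simpa using φ.injective e

/-! ### Labeled apartments. -/

namespace IsConsistentLabeling

variable {n : ℕ} {V : Type*} {𝒜 : Set (PreAbstractSimplicialComplex V)} {ℓ : V → ZMod n}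

theorem exists_vertexCoset_eq (hℓ : IsConsistentLabeling n 𝒜 ℓ)
    {K : PreAbstractSimplicialComplex V} (hK : K ∈ 𝒜) :
    ∃ φ : CoxeterComplexIso (affineAMatrix n) K, ∀ v, {v} ∈ K →
      ∃ w : (affineAMatrix n).Group, vertexCoset φ v =
        w • (specialSubgroup (affineAMatrix n) {ℓ v}ᶜ : Set (affineAMatrix n).Group) := by
  obtain ⟨φ, hφ⟩ := hℓ K hK
  refine ⟨φ, fun v hv => ?_⟩
  obtain ⟨w, hw⟩ := hφ v hv
  exact ⟨w, by rw [← hw]; simp [vertexCoset, hv]⟩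

-- Two cosets of the same subgroup that meet are equal, so equal labels would force `x = y`.
open Classical in
theorem ne_of_pair_mem (hℓ : IsConsistentLabeling n 𝒜 ℓ)
    {K : PreAbstractSimplicialComplex V} (hK : K ∈ 𝒜) {x y : V} (hxy : x ≠ y)
    (h : {x, y} ∈ K) : ℓ x ≠ ℓ y := by
  obtain ⟨φ, hφ⟩ := hℓ.exists_vertexCoset_eq hK
  have hx : {x} ∈ K := K.mem_of_subset h (by simp) (by simp)
  have hy : {y} ∈ K := K.mem_of_subset h (by simp) (by simp)
  obtain ⟨g, hg⟩ := (mem_iff_exists_mem_vertexCoset φ (by simp)).1 h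
  obtain ⟨u, hu⟩ := hφ x hx
  obtain ⟨v, hv⟩ := hφ y hy
  intro e
  apply hxy
  apply vertexCoset_injOn φ hx hy
  have h₁ := hg x (by simp)
  have h₂ := hg y (by simp)
  rw [hu, mem_leftCoset_iff, SetLike.mem_coe] at h₁
  rw [hv, mem_leftCoset_iff, SetLike.mem_coe, ← e] at h₂
  rw [hu, hv, ← e, leftCoset_eq_iff]
  simpa [mul_assoc] using mul_mem h₁ (inv_mem h₂)

open Classical in
/-- Apartments have no empty triangles. -/
theorem triple_mem (hℓ : IsConsistentLabeling n 𝒜 ℓ) (hn : 3 ≤ n)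
    {K : PreAbstractSimplicialComplex V} (hK : K ∈ 𝒜) {x y z : V} (hxy : {x, y} ∈ K)
    (hyz : {y, z} ∈ K) (hzx : {z, x} ∈ K) : {x, y, z} ∈ K := by
  obtain ⟨φ, hφ⟩ := hℓ.exists_vertexCoset_eq hK
  obtain ⟨u, hu⟩ := hφ x (K.mem_of_subset hxy (by simp) (by simp))
  obtain ⟨v, hv⟩ := hφ y (K.mem_of_subset hxy (by simp) (by simp))
  obtain ⟨w, hw⟩ := hφ z (K.mem_of_subset hyz (by simp) (by simp))
  obtain ⟨p, hp⟩ := (mem_iff_exists_mem_vertexCoset φ (by simp)).1 hxy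
  obtain ⟨q, hq⟩ := (mem_iff_exists_mem_vertexCoset φ (by simp)).1 hyz
  obtain ⟨r, hr⟩ := (mem_iff_exists_mem_vertexCoset φ (by simp)).1 hzx
  simp only [Finset.mem_insert, Finset.mem_singleton, forall_eq_or_imp, forall_eq, hu, hv, hw]
    at hp hq hr
  obtain ⟨g, h₁, h₂, h₃⟩ := exists_mem_three_cosets hn hp.1 hp.2 hq.1 hq.2 hr.1 hr.2
  refine (mem_iff_exists_mem_vertexCoset φ (by simp)).2 ⟨g, ?_⟩
  simpa [hu, hv, hw] using ⟨h₁, h₂, h₃⟩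

open Classical in
theorem pair_mem_of_opposite (hℓ : IsConsistentLabeling n 𝒜 ℓ) (hn : 3 ≤ n)
    {K : PreAbstractSimplicialComplex V} (hK : K ∈ 𝒜) {a b c d : V} (habc : {a, b, c} ∈ K)
    (habd : {a, b, d} ∈ K) (hd : (ℓ a - ℓ d).val < (ℓ a - ℓ b).val)
    (hc : (ℓ a - ℓ b).val < (ℓ a - ℓ c).val) : {c, d} ∈ K := by
  obtain ⟨φ, hφ⟩ := hℓ.exists_vertexCoset_eq hK
  obtain ⟨x, hx⟩ := hφ a (K.mem_of_subset habc (by simp) (by simp))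
  obtain ⟨y, hy⟩ := hφ b (K.mem_of_subset habc (by simp) (by simp))
  obtain ⟨z, hz⟩ := hφ c (K.mem_of_subset habc (by simp) (by simp))
  obtain ⟨t, ht⟩ := hφ d (K.mem_of_subset habd (by simp) (by simp))
  obtain ⟨g, hg⟩ := (mem_iff_exists_mem_vertexCoset φ (by simp)).1 habc
  obtain ⟨h, hh⟩ := (mem_iff_exists_mem_vertexCoset φ (by simp)).1 habd
  simp only [Finset.mem_insert, Finset.mem_singleton, forall_eq_or_imp, forall_eq, hx, hy, hz, ht]
    at hg hh
  obtain ⟨k, h₁, h₂⟩ := exists_mem_cosets_of_opposite hn hd hc hg.1 hg.2.1 hg.2.2 hh.1 hh.2.1 hh.2.2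
  refine (mem_iff_exists_mem_vertexCoset φ (by simp)).2 ⟨k, ?_⟩
  simpa [hz, ht] using ⟨h₁, h₂⟩

end IsConsistentLabeling

/-! ### From apartments to the building. -/

open Classical in
theorem skeletonGraph_adj_iff {V : Type*} {Δ : AbstractSimplicialComplex V} {x y : V} :
    (skeletonGraph Δ).Adj x y ↔ x ≠ y ∧ {x, y} ∈ Δ := by
  refine and_congr_right fun _ => ⟨?_, fun h => ⟨_, h, by simp⟩⟩
  rintro ⟨e, he, h⟩
  have : e = {x, y} := by
    apply Finset.coe_injective
    simpa using h
  exact this ▸ he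

namespace IsBuilding

variable {V : Type*} {Δ : AbstractSimplicialComplex V} {𝒜 : Set (PreAbstractSimplicialComplex V)}

open Classical in
/-- Vertices of an apartment that are adjacent in the building are adjacent in the apartment. -/
theorem pair_mem_apartment (hΔ : IsBuilding Δ 𝒜) {K : PreAbstractSimplicialComplex V} (hK : K ∈ 𝒜)
    {x y : V} (hx : {x} ∈ K) (hy : {y} ∈ K) (h : {x, y} ∈ Δ) : {x, y} ∈ K := by
  obtain ⟨L, hL, hxy, -⟩ := hΔ.common _ h _ h
  obtain ⟨φ, hφ⟩ := hΔ.iso L hL K hK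
  -- `φ` preserves faces and fixes `{x}` and `{y}`, so the image of the edge is a simplex of `K`
  -- containing both.
  refine K.mem_of_subset (φ ⟨_, hxy⟩).2 ?_ (by simp)
  have key : ∀ v ∈ ({x, y} : Finset V), {v} ∈ K → v ∈ (φ ⟨_, hxy⟩ : Finset V) := by
    intro v hv hvK
    have hs : {v} ⊆ ({x, y} : Finset V) := Finset.singleton_subset_iff.2 hv
    have hvL : {v} ∈ L := L.mem_of_subset hxy hs (by simp)
    have hle : (⟨{v}, hvL⟩ : L) ≤ ⟨_, hxy⟩ := hs
    have hle' : (φ ⟨{v}, hvL⟩ : Finset V) ⊆ (φ ⟨_, hxy⟩ : Finset V) := φ.monotone hle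
    rw [hφ _ hvL hvK] at hle'
    exact Finset.singleton_subset_iff.1 hle'
  intro v hv
  refine key v hv ?_
  rcases Finset.mem_insert.1 hv with rfl | hv
  · exact hx
  · rw [Finset.mem_singleton.1 hv]; exact hy

open Classical in
/-- Buildings of type `Ã` have no empty triangles. -/
theorem triple_mem (hΔ : IsBuilding Δ 𝒜) {n : ℕ} (hn : 3 ≤ n) {ℓ : V → ZMod n}
    (hℓ : IsConsistentLabeling n 𝒜 ℓ) {x y z : V} (hxy : {x, y} ∈ Δ) (hyz : {y, z} ∈ Δ)
    (hzx : {z, x} ∈ Δ) : {x, y, z} ∈ Δ := by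
  -- An apartment through the edge `{x, y}` and the vertex `z` contains the other two edges as well.
  obtain ⟨K, hK, hK₁, hz⟩ := hΔ.common _ hxy _ (Δ.singleton_mem z)
  have hx : {x} ∈ K := K.mem_of_subset hK₁ (by simp) (by simp)
  have hy : {y} ∈ K := K.mem_of_subset hK₁ (by simp) (by simp)
  exact hΔ.le K hK (hℓ.triple_mem hn hK hK₁ (hΔ.pair_mem_apartment hK hy hz hyz)
    (hΔ.pair_mem_apartment hK hz hx hzx))

theorem label_ne_of_adj (hΔ : IsBuilding Δ 𝒜) {n : ℕ} {ℓ : V → ZMod n}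
    (hℓ : IsConsistentLabeling n 𝒜 ℓ) {x y : V} (h : (skeletonGraph Δ).Adj x y) : ℓ x ≠ ℓ y := by
  classical
  obtain ⟨hne, hΔxy⟩ := skeletonGraph_adj_iff.1 h
  obtain ⟨K, hK, hxy, -⟩ := hΔ.common _ hΔxy _ hΔxy
  exact hℓ.ne_of_pair_mem hK hne hxy

end IsBuilding

theorem edgeLabel_add {V : Type*} {n : ℕ} [NeZero n] (ℓ : V → ZMod n) {x y z : V}
    (h : edgeLabel ℓ x y + edgeLabel ℓ y z < n) :
    edgeLabel ℓ x z = edgeLabel ℓ x y + edgeLabel ℓ y z := by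
  rw [edgeLabel, edgeLabel, edgeLabel, ← ZMod.val_add_of_lt h, sub_add_sub_cancel]

theorem mainTheorem8 {n : ℕ} (hn : 2 ≤ n) {V : Type*} (Δ : AbstractSimplicialComplex V)
    (𝒜 : Set (PreAbstractSimplicialComplex V)) (hΔ : IsBuilding Δ 𝒜) (htype : IsTypeAffineA n 𝒜)
    (hfin : IsLocallyFinite Δ) (ℓ : V → ZMod n) (hℓ : IsConsistentLabeling n 𝒜 ℓ)
    (a b c d : V)
    (habc : HasCycle (skeletonGraph Δ) a b c) (hadb : HasCycle (skeletonGraph Δ) a d b)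
    (hsum : edgeLabel ℓ a d + edgeLabel ℓ d b + edgeLabel ℓ b c < n) :
    (skeletonGraph Δ).Adj c d ∧
      HasCycle (skeletonGraph Δ) a c d ∧ HasCycle (skeletonGraph Δ) b d c := by
  classical
  have : NeZero n := ⟨by omega⟩
  obtain ⟨hab, hbc, hca⟩ := habc
  obtain ⟨had, hdb, hba⟩ := hadb
  have hpos : ∀ {x y : V}, (skeletonGraph Δ).Adj x y → 0 < edgeLabel ℓ x y := fun h =>
    Nat.pos_of_ne_zero fun e => hΔ.label_ne_of_adj hℓ h
      (sub_eq_zero.1 ((ZMod.val_eq_zero _).1 e))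
  have h₁ := hpos had
  have h₂ := hpos hdb
  have h₃ := hpos hbc
  have hn₃ : 3 ≤ n := by omega
  -- Each partial sum is below `n`, so no reduction modulo `n` occurs.
  have eab := edgeLabel_add ℓ (x := a) (y := d) (z := b) (by omega)
  have eac := edgeLabel_add ℓ (x := a) (y := b) (z := c) (by omega)
  have edc := edgeLabel_add ℓ (x := d) (y := b) (z := c) (by omega)
  have hcd : (skeletonGraph Δ).Adj c d := by
    refine skeletonGraph_adj_iff.2 ⟨?_, ?_⟩
    -- If `c = d`, the label of `d → c` would be `0`, yet it is a sum of two positive labels.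
    · rintro rfl
      simp only [edgeLabel, sub_self, ZMod.val_zero] at edc h₂
      omega
    · have tabc := hΔ.triple_mem hn₃ hℓ (skeletonGraph_adj_iff.1 hab).2
        (skeletonGraph_adj_iff.1 hbc).2 (skeletonGraph_adj_iff.1 hca).2
      have tabd := hΔ.triple_mem hn₃ hℓ (skeletonGraph_adj_iff.1 hab).2
        (skeletonGraph_adj_iff.1 hdb.symm).2 (skeletonGraph_adj_iff.1 had.symm).2
      obtain ⟨K, hK, hK₁, hK₂⟩ := hΔ.common _ tabc _ tabd
      refine hΔ.le K hK (hℓ.pair_mem_of_opposite hn₃ hK hK₁ hK₂ ?_ ?_)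
      · change edgeLabel ℓ a d < edgeLabel ℓ a b
        omega
      · change edgeLabel ℓ a b < edgeLabel ℓ a c
        omega
  exact ⟨hcd, ⟨hca.symm, hcd, had.symm⟩, ⟨hdb.symm, hcd.symm, hbc.symm⟩⟩
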